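/- Let $H$ be a separable, infinite-dimensional complex Hilbert space, let $B(H)$ be the algebra of bounded linear operators on $H$, and let $A \in B(H)$ have spectrum $\sigma(A) = \{1\}$ (so that $A$ is invertible). Suppose that there exist a positive integer $r$ and a nonzero complex constant $\lambda$ such that $$\|A^{-n} + \lambda A^{n}\| = O(n^r) \quad \text{as } n \to +\infty .$$ Then $(A - I)^{r+4} = 0$. -/

import Mathlib

open Filter Asymptotics

/-!
Write `A' = A⁻¹`, `N = A - 1`, `S = A - A'` and `f n = A' ^ n + l A ^ n`.

Growth on both sides. From `S * f (n + 1) = S A' ^ (n + 1) + l S A ^ (n + 1)` and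
`f n - f (n + 2) = S A' ^ (n + 1) - l S A ^ (n + 1)`, both `S A ^ n` and `S A' ^ n` are `O(n ^ r)`.
The one-sided hypothesis on `f` therefore controls `S A ^ n` for all integers `n`.

Resolvent. Since `σ(A) = {1}`, the function `w ↦ (1 - w N)⁻¹ S` is entire. Put `u = w + 1/2`.
According to the sign of `Re u`, the resolvent is a geometric series in `A` or in `A'`, and the growth
of `S A ^ n` gives `‖(1 - w N)⁻¹ S‖ * |2 Re u| ^ (r + 1) ≤ C (‖u‖ + 1) ^ (2 r + 1)`
(`norm_mul_le_of_pow_growth`). The singularity on the line `Re u = 0` is removed by the maximum principle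
for `(u ^ 2 + R ^ 2) ^ (r + 1) (1 - w N)⁻¹ S` on `‖u‖ ≤ R`, because `|u ^ 2 + R ^ 2| = R |2 Re u|` on the
boundary circle (`exists_norm_le_pow_of_norm_mul_abs_re_pow_le`). Hence `(1 - w N)⁻¹ S = O(|w| ^ r)`,
and Liouville's theorem yields `N ^ (r + 1) S = 0` (`pow_mul_eq_zero_of_resolvent_growth`).
As `S = N (1 + A')` with `1 + A'` invertible, `N ^ (r + 2) = 0`, which is stronger than required.
-/

/-! ### Resolvent bounds from polynomial growth of powers -/

/-- If `‖T ^ n Y‖ ≤ C (n + 1) ^ r`, then `(b - a T)⁻¹ Y`, which is the geometric series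
`b⁻¹ ∑ (a / b) ^ n T ^ n Y`, blows up at most like the power `-(r + 1)` of `|b| ^ 2 - |a| ^ 2`. -/
theorem norm_mul_le_of_pow_growth {R : Type*} [NormedRing R] [NormedAlgebra ℂ R] [CompleteSpace R]
    {T Y V : R} {C : ℝ} {r : ℕ} (hT : ∀ n : ℕ, ‖T ^ n * Y‖ ≤ C * ((n : ℝ) + 1) ^ r)
    {a b : ℂ} (hab : ‖a‖ < ‖b‖) (hV : V * (b • (1 : R) - a • T) = 1) :
    ‖V * Y‖ * (‖b‖ ^ 2 - ‖a‖ ^ 2) ^ (r + 1) ≤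
      C * r.factorial * 2 ^ (r + 1) * ‖b‖ ^ (2 * r + 1) := by
  have hb0 : 0 < ‖b‖ := (norm_nonneg a).trans_lt hab
  have hb : b ≠ 0 := norm_pos_iff.mp hb0
  have hC : 0 ≤ C := by
    have := (norm_nonneg _).trans (hT 0)
    simpa using this
  set t : ℂ := a / b with ht
  have htn : ‖t‖ < 1 := by rw [ht, norm_div]; exact (div_lt_one hb0).2 hab
  have hbt : b * t = a := by rw [ht]; field_simp
  have hsum : HasSum (fun n : ℕ => C * r.factorial * (((n + r).choose r : ℝ) * ‖t‖ ^ n))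
      (C * r.factorial * (1 / (1 - ‖t‖) ^ (r + 1))) :=
    (hasSum_choose_mul_geometric_of_norm_lt_one r (r := ‖t‖) (by simpa using htn)).mul_left _
  have hbound : ∀ n : ℕ, ‖t ^ n • (T ^ n * Y)‖ ≤
      C * r.factorial * (((n + r).choose r : ℝ) * ‖t‖ ^ n) := by
    intro n
    have h1 : ((n : ℝ) + 1) ^ r ≤ r.factorial * ((n + r).choose r : ℝ) := by
      have := Nat.pow_succ_le_ascFactorial (n + 1) r
      rw [Nat.ascFactorial_eq_factorial_mul_choose] at this
      exact_mod_cast this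
    rw [norm_smul, norm_pow]
    calc ‖t‖ ^ n * ‖T ^ n * Y‖ ≤ ‖t‖ ^ n * (C * (r.factorial * ((n + r).choose r : ℝ))) := by
          gcongr; exact (hT n).trans (by gcongr)
      _ = _ := by ring
  set G : R := ∑' n : ℕ, t ^ n • (T ^ n * Y) with hG
  have hs : Summable fun n : ℕ => t ^ n • (T ^ n * Y) :=
    Summable.of_norm_bounded hsum.summable hbound
  have hGn : ‖G‖ ≤ C * r.factorial * (1 / (1 - ‖t‖) ^ (r + 1)) :=
    tsum_of_norm_bounded hsum hbound
  have hGY : G = Y + t • (T * G) := by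
    have h1 : t • (T * G) = ∑' n : ℕ, t ^ (n + 1) • (T ^ (n + 1) * Y) := by
      rw [hG, ← hs.tsum_mul_left, ← tsum_const_smul'']
      simp [pow_succ', smul_smul, mul_assoc]
    rw [h1, hG, hs.tsum_eq_zero_add]
    simp
  have hVY : V * Y = b⁻¹ • G := by
    have h1 : (b • (1 : R) - a • T) * G = b • Y := by
      rw [sub_mul, smul_mul_assoc, smul_mul_assoc, one_mul]
      nth_rewrite 1 [hGY]
      rw [smul_add, smul_smul, hbt]; abel
    have h2 : G = b • (V * Y) := by
      rw [← mul_smul_comm, ← h1, ← mul_assoc, hV, one_mul]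
    rw [h2, smul_smul, inv_mul_cancel₀ hb, one_smul]
  have ht1 : 0 < 1 - ‖t‖ := by linarith
  -- `|b| ^ 2 - |a| ^ 2 = |b| ^ 2 (1 - |t|) (1 + |t|)` and `1 + |t| ≤ 2`.
  have hdiff : ‖b‖ ^ 2 - ‖a‖ ^ 2 ≤ 2 * ‖b‖ ^ 2 * (1 - ‖t‖) := by
    have : ‖a‖ = ‖b‖ * ‖t‖ := by rw [← hbt, norm_mul]
    rw [this]
    nlinarith [mul_nonneg (sq_nonneg ‖b‖) (sq_nonneg (1 - ‖t‖))]
  have hd0 : 0 ≤ ‖b‖ ^ 2 - ‖a‖ ^ 2 := by nlinarith [norm_nonneg a]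
  rw [hVY, norm_smul, norm_inv]
  calc ‖b‖⁻¹ * ‖G‖ * (‖b‖ ^ 2 - ‖a‖ ^ 2) ^ (r + 1)
      ≤ ‖b‖⁻¹ * (C * r.factorial * (1 / (1 - ‖t‖) ^ (r + 1))) *
        (2 * ‖b‖ ^ 2 * (1 - ‖t‖)) ^ (r + 1) := by gcongr
    _ = C * r.factorial * 2 ^ (r + 1) * ‖b‖ ^ (2 * r + 1) := by
        rw [mul_pow, mul_pow, ← pow_mul, show 2 * (r + 1) = (2 * r + 1) + 1 by ring, pow_succ ‖b‖]
        field_simp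

/-! ### Entire functions with a polynomial bound away from a line -/

/-- On the circle of radius `R`, `u ^ 2 + R ^ 2 = u (u + conj u)`, so this factor absorbs powers of
the distance to the imaginary axis. -/
theorem norm_sq_add_sq_of_norm_eq {u : ℂ} {R : ℝ} (hu : ‖u‖ = R) :
    ‖u ^ 2 + (R : ℂ) ^ 2‖ = R * |2 * u.re| := by
  have h : u ^ 2 + (R : ℂ) ^ 2 = u * ((2 * u.re : ℝ) : ℂ) := by
    rw [← hu, ← Complex.mul_conj', ← Complex.add_conj]; ring
  rw [h, norm_mul, hu, Complex.norm_real, Real.norm_eq_abs]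

/-- A polynomial bound for an entire function that degenerates along the imaginary axis improves to a
genuine polynomial bound, with the exponent reduced accordingly. -/
theorem exists_norm_le_pow_of_norm_mul_abs_re_pow_le {E : Type*} [NormedAddCommGroup E]
    [NormedSpace ℂ E] {g : ℂ → E} (hg : Differentiable ℂ g) {C : ℝ} {r : ℕ}
    (h : ∀ u, ‖g u‖ * |2 * u.re| ^ (r + 1) ≤ C * (‖u‖ + 1) ^ (2 * r + 1)) :
    ∃ D, ∀ u, 1 ≤ ‖u‖ → ‖g u‖ ≤ D * ‖u‖ ^ r := by
  have hC : 0 ≤ C := by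
    have := (by positivity : (0:ℝ) ≤ _).trans (h 0)
    simpa using this
  refine ⟨C * 2 ^ (r + 1) * 4 ^ (2 * r + 1), fun u hu => ?_⟩
  -- On the disc of radius `2 ‖u‖` the point `u` stays away from the zeros `± i R` of the factor.
  set R : ℝ := 2 * ‖u‖ with hR
  have hR1 : 1 ≤ R := by linarith
  let F : ℂ → E := fun z => (z ^ 2 + (R : ℂ) ^ 2) ^ (r + 1) • g z
  have hF : Differentiable ℂ F := by fun_prop
  have hmax : ‖F u‖ ≤ C * R ^ (r + 1) * (2 * R) ^ (2 * r + 1) := by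
    refine Complex.norm_le_of_forall_mem_frontier_norm_le (U := Metric.ball 0 R)
      Metric.isBounded_ball hF.diffContOnCl (fun z hz => ?_) (subset_closure ?_)
    · rw [frontier_ball _ (by linarith), mem_sphere_zero_iff_norm] at hz
      calc ‖F z‖ = R ^ (r + 1) * (‖g z‖ * |2 * z.re| ^ (r + 1)) := by
            simp only [F]
            rw [norm_smul, norm_pow, norm_sq_add_sq_of_norm_eq hz, mul_pow]; ring
        _ ≤ R ^ (r + 1) * (C * (2 * R) ^ (2 * r + 1)) := by
            refine mul_le_mul_of_nonneg_left ((h z).trans ?_) (by positivity)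
            rw [hz]; gcongr; linarith
        _ = _ := by ring
    · rw [mem_ball_zero_iff]; linarith
  have hlow : ‖u‖ ^ 2 ≤ ‖u ^ 2 + (R : ℂ) ^ 2‖ := by
    have h1 := norm_sub_norm_le ((R : ℂ) ^ 2) (-u ^ 2)
    rw [sub_neg_eq_add, add_comm, norm_pow, Complex.norm_real, Real.norm_eq_abs,
      abs_of_pos (by linarith), norm_neg, norm_pow] at h1
    nlinarith [sq_nonneg ‖u‖]
  have hle : (‖u‖ ^ 2) ^ (r + 1) * ‖g u‖ ≤
      (‖u‖ ^ 2) ^ (r + 1) * (C * 2 ^ (r + 1) * 4 ^ (2 * r + 1) * ‖u‖ ^ r) := by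
    calc (‖u‖ ^ 2) ^ (r + 1) * ‖g u‖ ≤ ‖F u‖ := by
          simp only [F]; rw [norm_smul, norm_pow]; gcongr
      _ ≤ C * R ^ (r + 1) * (2 * R) ^ (2 * r + 1) := hmax
      _ = _ := by
          rw [show 2 * R = 4 * ‖u‖ by rw [hR]; ring, hR, mul_pow, mul_pow, ← pow_mul]
          ring
  exact le_of_mul_le_mul_left hle (by positivity)

/-- Liouville's theorem for `w ↦ N ^ (r + 1) (1 - w N)⁻¹ S`, the remainder of the Neumann series of
`(1 - w N)⁻¹ S` after `r + 1` terms, divided by `w ^ (r + 1)`. -/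
theorem pow_mul_eq_zero_of_resolvent_growth {R : Type*} [NormedRing R] [NormedAlgebra ℂ R]
    {N S : R} {V : ℂ → R} (hVd : Differentiable ℂ V)
    (hV : ∀ w : ℂ, (1 - w • N) * V w = 1) {D : ℝ} {r : ℕ}
    (hD : ∀ w : ℂ, 2 ≤ ‖w‖ → ‖V w * S‖ ≤ D * ‖w‖ ^ r) : N ^ (r + 1) * S = 0 := by
  set K : ℝ := ∑ k ∈ Finset.range (r + 1), ‖N ^ k * S‖
  have hFd : Differentiable ℂ fun w => N ^ (r + 1) * (V w * S) := by fun_prop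
  have hid : ∀ w : ℂ, w ^ (r + 1) • (N ^ (r + 1) * (V w * S)) =
      V w * S - ∑ k ∈ Finset.range (r + 1), w ^ k • (N ^ k * S) := by
    intro w
    have h1 := congrArg (· * (V w * S)) (geom_sum_mul_neg (w • N) (r + 1))
    have h2 : (1 - w • N) * (V w * S) = S := by rw [← mul_assoc, hV, one_mul]
    simp only [mul_assoc, h2, sub_mul _ _ (V w * S), one_mul] at h1
    simp only [smul_pow, Finset.sum_mul, smul_mul_assoc] at h1
    rw [h1]; simp
  have hbd : ∀ w : ℂ, 2 ≤ ‖w‖ → ‖N ^ (r + 1) * (V w * S)‖ ≤ (D + K) * ‖w‖⁻¹ := by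
    intro w hw
    have hw0 : 0 < ‖w‖ := by linarith
    have h2 : ‖∑ k ∈ Finset.range (r + 1), w ^ k • (N ^ k * S)‖ ≤ K * ‖w‖ ^ r := by
      rw [Finset.sum_mul]
      refine norm_sum_le_of_le _ fun k hk => ?_
      rw [norm_smul, norm_pow, mul_comm]
      gcongr
      · linarith
      · exact Nat.lt_succ_iff.mp (Finset.mem_range.mp hk)
    have h3 : ‖w‖ ^ r * (‖w‖ * ‖N ^ (r + 1) * (V w * S)‖) ≤ ‖w‖ ^ r * (D + K) := by
      calc _ = ‖w ^ (r + 1) • (N ^ (r + 1) * (V w * S))‖ := by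
            rw [norm_smul, norm_pow]; ring
        _ ≤ D * ‖w‖ ^ r + K * ‖w‖ ^ r := by
            rw [hid]; exact (norm_sub_le _ _).trans (add_le_add (hD w hw) h2)
        _ = _ := by ring
    have h4 := le_of_mul_le_mul_left h3 (by positivity)
    rw [← div_eq_mul_inv, le_div_iff₀ hw0, mul_comm]; exact h4
  have hlim : Tendsto (fun w => N ^ (r + 1) * (V w * S)) (cocompact ℂ) (nhds 0) := by
    have hn : Tendsto (fun w : ℂ => ‖w‖) (cocompact ℂ) atTop := tendsto_norm_cocompact_atTop
    refine squeeze_zero_norm' ((hn.eventually_ge_atTop 2).mono hbd) ?_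
    simpa using (tendsto_inv_atTop_zero.comp hn).const_mul (D + K)
  have hV0 : V 0 = 1 := by simpa using hV 0
  simpa [hV0] using hFd.apply_eq_of_tendsto_cocompact 0 hlim

/-! ### Two-sided growth and nilpotency -/

/-- A Gelfand–Hille theorem: if `‖A ^ n S‖ = O(|n| ^ r)` for `n ∈ ℤ` (with `A'` the inverse of `A`) and
`A - 1` is quasinilpotent, then `(A - 1) ^ (r + 1)` annihilates `S`. -/
theorem sub_one_pow_mul_eq_zero_of_growth {R : Type*} [NormedRing R] [NormedAlgebra ℂ R]
    [CompleteSpace R] {A A' S : R} (hAA' : A * A' = 1)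
    (hu : ∀ w : ℂ, IsUnit (1 - w • (A - 1))) {C : ℝ} {r : ℕ}
    (h1 : ∀ n : ℕ, ‖A ^ n * S‖ ≤ C * ((n : ℝ) + 1) ^ r)
    (h2 : ∀ n : ℕ, ‖A' ^ n * (A' * S)‖ ≤ C * ((n : ℝ) + 1) ^ r) :
    (A - 1) ^ (r + 1) * S = 0 := by
  set V : ℂ → R := fun w => Ring.inverse (1 - w • (A - 1)) with hVdef
  have hVl : ∀ w, V w * (1 - w • (A - 1)) = 1 := fun w => Ring.inverse_mul_cancel _ (hu w)
  have hVr : ∀ w, (1 - w • (A - 1)) * V w = 1 := fun w => Ring.mul_inverse_cancel _ (hu w)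
  have hVd : Differentiable ℂ V := fun w =>
    DifferentiableAt.inverse (h := fun w : ℂ => 1 - w • (A - 1)) (by fun_prop) (hu w)
  have hC : 0 ≤ C := by
    have := (norm_nonneg _).trans (h1 0)
    simpa using this
  have hgd : Differentiable ℂ fun u : ℂ => V (u - 1 / 2) * S :=
    (hVd.comp (differentiable_id.sub_const _)).mul_const S
  have hsq : ∀ u : ℂ, ‖u + 1 / 2‖ ^ 2 - ‖u - 1 / 2‖ ^ 2 = 2 * u.re := by
    intro u
    rw [← Complex.normSq_eq_norm_sq, ← Complex.normSq_eq_norm_sq, Complex.normSq_apply,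
      Complex.normSq_apply]
    simp; ring
  have hhalf : ‖(1 / 2 : ℂ)‖ = 1 / 2 := by norm_num
  have hgb : ∀ u : ℂ, ‖V (u - 1 / 2) * S‖ * |2 * u.re| ^ (r + 1) ≤
      (C * r.factorial * 2 ^ (r + 1)) * (‖u‖ + 1) ^ (2 * r + 1) := by
    intro u
    rcases lt_trichotomy u.re 0 with hre | hre | hre
    · have hlt : ‖u + 1 / 2‖ < ‖u - 1 / 2‖ :=
        lt_of_pow_lt_pow_left₀ 2 (norm_nonneg _) (by linarith [hsq u])
      -- For `Re u < 0` the resolvent is expanded in powers of the inverse.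
      have hinv : -(V (u - 1 / 2) * A) * ((u - 1 / 2) • (1 : R) - (u + 1 / 2) • A') = 1 := by
        refine Eq.trans ?_ (hVl (u - 1 / 2))
        rw [neg_mul, mul_assoc, ← mul_neg]
        congr 1
        rw [mul_sub, mul_smul_comm, mul_smul_comm, hAA', mul_one]
        module
      have key := norm_mul_le_of_pow_growth h2 hlt hinv
      have hV' : -(V (u - 1 / 2) * A) * (A' * S) = -(V (u - 1 / 2) * S) := by
        rw [neg_mul, mul_assoc, ← mul_assoc A, hAA', one_mul]
      rw [hV', norm_neg, show ‖u - 1 / 2‖ ^ 2 - ‖u + 1 / 2‖ ^ 2 = |2 * u.re| by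
        rw [abs_of_neg (by linarith)]; linarith [hsq u]] at key
      refine key.trans ?_
      gcongr
      linarith [norm_sub_le u (1 / 2)]
    · rw [hre]; simp; positivity
    · have hlt : ‖u - 1 / 2‖ < ‖u + 1 / 2‖ :=
        lt_of_pow_lt_pow_left₀ 2 (norm_nonneg _) (by linarith [hsq u])
      have hinv : V (u - 1 / 2) * ((u + 1 / 2) • (1 : R) - (u - 1 / 2) • A) = 1 := by
        refine Eq.trans ?_ (hVl (u - 1 / 2))
        congr 1
        module
      have key := norm_mul_le_of_pow_growth h1 hlt hinv
      rw [hsq, ← abs_of_pos (show 0 < 2 * u.re by linarith)] at key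
      refine key.trans ?_
      gcongr
      linarith [norm_add_le u (1 / 2)]
  obtain ⟨D, hD⟩ := exists_norm_le_pow_of_norm_mul_abs_re_pow_le hgd hgb
  have hD0 : 0 ≤ D := by
    have := (norm_nonneg _).trans (hD 1 (by simp))
    simpa using this
  refine pow_mul_eq_zero_of_resolvent_growth hVd hVr (D := D * 2 ^ r) fun w hw => ?_
  have hw1 := norm_sub_le (w + 1 / 2) (1 / 2)
  have hw2 := norm_add_le w (1 / 2)
  rw [add_sub_cancel_right] at hw1
  have := hD (w + 1 / 2) (by linarith)
  rw [add_sub_cancel_right] at this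
  calc ‖V w * S‖ ≤ D * ‖w + 1 / 2‖ ^ r := this
    _ ≤ D * (2 * ‖w‖) ^ r := by gcongr; linarith
    _ = D * 2 ^ r * ‖w‖ ^ r := by ring

/-- The one-sided growth of `A' ^ n + l A ^ n` controls `(A - A') A ^ n` for positive and negative `n`:
multiplying by `A - A'` or taking the difference of the terms of index `n` and `n + 2` produces
the sum and the difference of the two halves. -/
theorem exists_growth_sub_inverse {R : Type*} [NormedRing R] [NormedAlgebra ℂ R] {A A' : R}
    (hAA' : A * A' = 1) (hA'A : A' * A = 1) {l : ℂ} (hl : l ≠ 0) {C : ℝ} {r : ℕ}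
    (h : ∀ n : ℕ, ‖A' ^ n + l • A ^ n‖ ≤ C * ((n : ℝ) + 1) ^ r) :
    ∃ D : ℝ, ∀ n : ℕ, ‖A ^ n * (A - A')‖ ≤ D * ((n : ℝ) + 1) ^ r ∧
      ‖A' ^ n * (A' * (A - A'))‖ ≤ D * ((n : ℝ) + 1) ^ r := by
  have hC : 0 ≤ C := by
    have := (norm_nonneg _).trans (h 0)
    simpa using this
  set f : ℕ → R := fun n => A' ^ n + l • A ^ n with hf
  have hcA : ∀ n, A * A' ^ (n + 1) = A' ^ n := fun n => by rw [pow_succ', ← mul_assoc, hAA', one_mul]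
  have hcA' : ∀ n, A' * A ^ (n + 1) = A ^ n := fun n => by rw [pow_succ', ← mul_assoc, hA'A, one_mul]
  have hcA2 : ∀ n, A' ^ (n + 1) * A = A' ^ n := fun n => by rw [pow_succ, mul_assoc, hA'A, mul_one]
  have hcA'2 : ∀ n, A ^ (n + 1) * A' = A ^ n := fun n => by rw [pow_succ, mul_assoc, hAA', mul_one]
  have hprod : ∀ n, (A - A') * f (n + 1) =
      A' ^ n - A' ^ (n + 2) + l • (A ^ (n + 2) - A ^ n) := by
    intro n
    simp only [hf, sub_mul, mul_add, mul_smul_comm, hcA, hcA', ← pow_succ']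
  have hneg : ∀ n, A' ^ n * (A' * (A - A')) =
      (2⁻¹ : ℂ) • ((A - A') * f (n + 1) + (f n - f (n + 2))) := by
    intro n
    rw [hprod, ← mul_assoc, ← pow_succ, mul_sub, hcA2, ← pow_succ]
    simp only [hf]
    module
  have hpos : ∀ n, A ^ n * (A - A') =
      (2⁻¹ * l⁻¹ : ℂ) • (A' * ((A - A') * f (n + 1) - (f n - f (n + 2)))) := by
    intro n
    have h1 : (A - A') * f (n + 1) - (f n - f (n + 2)) = (2 * l) • (A ^ (n + 2) - A ^ n) := by
      rw [hprod]; simp only [hf]; module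
    have h2 : A ^ n * (A - A') = A' * (A ^ (n + 2) - A ^ n) := by
      rw [mul_sub, mul_sub, hcA', ← pow_succ]
      congr 1
      cases n with
      | zero => simp
      | succ k => rw [hcA', hcA'2]
    rw [h1, mul_smul_comm, smul_smul, h2, show (2⁻¹ * l⁻¹ : ℂ) * (2 * l) = 1 by field_simp, one_smul]
  have hfb : ∀ n k : ℕ, k ≤ 2 → ‖f (n + k)‖ ≤ C * 3 ^ r * ((n : ℝ) + 1) ^ r := by
    intro n k hk
    have hk' : (k : ℝ) ≤ 2 := by exact_mod_cast hk
    calc ‖f (n + k)‖ ≤ C * (((n + k : ℕ) : ℝ) + 1) ^ r := h _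
      _ ≤ C * (3 * ((n : ℝ) + 1)) ^ r := by
          gcongr; push_cast; nlinarith [(Nat.cast_nonneg n : (0 : ℝ) ≤ n)]
      _ = _ := by rw [mul_pow]; ring
  set K : ℝ := (‖A - A'‖ + 2) * (C * 3 ^ r) with hK
  have hK0 : 0 ≤ K := by positivity
  have hSf : ∀ n, ‖(A - A') * f (n + 1)‖ ≤ ‖A - A'‖ * (C * 3 ^ r * ((n : ℝ) + 1) ^ r) := fun n =>
    (norm_mul_le _ _).trans (by gcongr; exact hfb n 1 (by norm_num))
  have hff : ∀ n, ‖f n - f (n + 2)‖ ≤ 2 * (C * 3 ^ r * ((n : ℝ) + 1) ^ r) := fun n => by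
    have h0 := hfb n 0 (by norm_num)
    have h2 := hfb n 2 le_rfl
    rw [add_zero] at h0
    linarith [norm_sub_le (f n) (f (n + 2))]
  refine ⟨‖(2⁻¹ * l⁻¹ : ℂ)‖ * ‖A'‖ * K + ‖(2⁻¹ : ℂ)‖ * K, fun n => ⟨?_, ?_⟩⟩
  · rw [hpos, norm_smul]
    calc _ ≤ ‖(2⁻¹ * l⁻¹ : ℂ)‖ * (‖A'‖ * (K * ((n : ℝ) + 1) ^ r)) := by
          gcongr
          refine (norm_mul_le _ _).trans (mul_le_mul_of_nonneg_left ?_ (norm_nonneg _))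
          refine (norm_sub_le _ _).trans ((add_le_add (hSf n) (hff n)).trans_eq ?_)
          rw [hK]; ring
      _ ≤ ‖(2⁻¹ * l⁻¹ : ℂ)‖ * (‖A'‖ * (K * ((n : ℝ) + 1) ^ r)) +
          ‖(2⁻¹ : ℂ)‖ * (K * ((n : ℝ) + 1) ^ r) := le_add_of_nonneg_right (by positivity)
      _ = _ := by ring
  · rw [hneg, norm_smul]
    calc _ ≤ ‖(2⁻¹ : ℂ)‖ * (K * ((n : ℝ) + 1) ^ r) := by
          gcongr
          refine (norm_add_le _ _).trans ((add_le_add (hSf n) (hff n)).trans_eq ?_)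
          rw [hK]; ring
      _ ≤ ‖(2⁻¹ * l⁻¹ : ℂ)‖ * (‖A'‖ * (K * ((n : ℝ) + 1) ^ r)) +
          ‖(2⁻¹ : ℂ)‖ * (K * ((n : ℝ) + 1) ^ r) := le_add_of_nonneg_left (by positivity)
      _ = _ := by ring

/-- The result in a complex Banach algebra, with the exponent `r + 2`. -/
theorem sub_one_pow_eq_zero_of_isBigO {R : Type*} [NormedRing R] [NormedAlgebra ℂ R]
    [CompleteSpace R] {A : R} (hA : spectrum ℂ A = {1}) {r : ℕ} {l : ℂ} (hl : l ≠ 0)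
    (hgrowth : (fun n : ℕ => ‖(Ring.inverse A) ^ n + l • A ^ n‖) =O[atTop]
      (fun n : ℕ => (n : ℝ) ^ r)) :
    (A - 1) ^ (r + 2) = 0 := by
  have hunit : ∀ z : ℂ, z ≠ 1 → IsUnit (A - z • (1 : R)) := by
    intro z hz
    have : z ∉ spectrum ℂ A := by rw [hA]; simpa using hz
    rw [spectrum.notMem_iff, IsUnit.sub_iff, Algebra.algebraMap_eq_smul_one] at this
    exact this
  have hA0 : IsUnit A := by simpa using hunit 0 (by simp)
  set A' := Ring.inverse A with hA'
  have hAA' : A * A' = 1 := Ring.mul_inverse_cancel _ hA0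
  have hA'A : A' * A = 1 := Ring.inverse_mul_cancel _ hA0
  have hu : ∀ w : ℂ, IsUnit (1 - w • (A - 1)) := by
    intro w
    rcases eq_or_ne w 0 with rfl | hw
    · simp
    · have h1 := hunit (1 + w⁻¹) (by simpa using hw)
      have h2 : 1 - w • (A - 1) = Units.mk0 (-w) (neg_ne_zero.2 hw) • (A - (1 + w⁻¹) • (1 : R)) := by
        rw [Units.smul_mk0]
        have : (-w) * (1 + w⁻¹) = -w - 1 := by field_simp; ring
        rw [smul_sub (-w), smul_smul, this]
        module
      rw [h2]
      exact h1.smul _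
  have hO : (fun n : ℕ => A' ^ n + l • A ^ n) =O[atTop] (fun n : ℕ => ((n : ℝ) + 1) ^ r) := by
    refine hgrowth.of_norm_left.trans (IsBigO.of_bound 1 (Eventually.of_forall fun n => ?_))
    rw [Real.norm_of_nonneg (by positivity), Real.norm_of_nonneg (by positivity), one_mul]
    gcongr
    linarith
  rw [isBigO_nat_atTop_iff fun n h0 => absurd h0 (by positivity)] at hO
  obtain ⟨C, hC⟩ := hO
  obtain ⟨D, hD⟩ := exists_growth_sub_inverse hAA' hA'A hl (C := C) (r := r) fun n => by
    have := hC n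
    rwa [Real.norm_of_nonneg (by positivity)] at this
  have hzero := sub_one_pow_mul_eq_zero_of_growth hAA' hu (fun n => (hD n).1) fun n => (hD n).2
  have hS : A - A' = (A - 1) * (1 + A') := by
    rw [sub_mul, mul_add, hAA', one_mul, mul_one]; abel
  -- `1 + A⁻¹ = A⁻¹ (A + 1)` is invertible because `-1` is not in the spectrum.
  have hinv : IsUnit (1 + A') := by
    have h1 : IsUnit (A + 1) := by
      simpa using hunit (-1) (by norm_num)
    have h2 : 1 + A' = A' * (A + 1) := by rw [mul_add, hA'A, mul_one]
    rw [h2]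
    exact (Units.mk A' A hA'A hAA').isUnit.mul h1
  rw [hS, ← mul_assoc, ← pow_succ] at hzero
  exact hinv.mul_left_eq_zero.1 hzero

theorem mainTheorem6 {H : Type*} [NormedAddCommGroup H] [InnerProductSpace ℂ H] [CompleteSpace H]
    [TopologicalSpace.SeparableSpace H] (hH : ¬ FiniteDimensional ℂ H)
    (A : H →L[ℂ] H) (hA : spectrum ℂ A = {1})
    (r : ℕ) (hr : 0 < r) (l : ℂ) (hl : l ≠ 0)
    (hgrowth : (fun n : ℕ => ‖(Ring.inverse A) ^ n + l • A ^ n‖) =O[atTop]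
      (fun n : ℕ => (n : ℝ) ^ r)) :
    (A - 1) ^ (r + 4) = 0 := by
  rw [show r + 4 = r + 2 + 2 by ring, pow_add, sub_one_pow_eq_zero_of_isBigO hA hl hgrowth, zero_mul]
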